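/- Let $d\ge 1$ be an integer and $L>0$. For $s\ge 0$ let $\|g\|_{H^s(\mathbb R^d)}^2=\int_{\mathbb R^d}(1+|\xi|^2)^s|\hat g(\xi)|^2\,d\xi$ for $g\in L^2(\mathbb R^d)$, where $\hat g$ is the unitary Fourier transform, $\hat g(\xi)=(2\pi)^{-d/2}\int g(x)e^{-i\langle x,\xi\rangle}\,dx$ for integrable $g$. For $f:[0,1]^d\to\mathbb R$ let $\|f\|_{H^s([0,1]^d)}$ be the infimum of $\|g\|_{H^s(\mathbb R^d)}$ over all $g\in L^2(\mathbb R^d)$ with $g=f$ a.e. on $[0,1]^d$; $H^s([0,1]^d)$ consists of the $f$ for which this is finite. Given a function $f$ on $[0,1]^d$, a law $P_X$ on $[0,1]^d$ and a law $P_\xi$ on $\mathbb R$, let $\mathcal D_n=\{(X_i,Y_i)\}_{i=1}^n$ with $Y_i=f(X_i)+\xi_i$, where $X_1,\dots,X_n\sim P_X$ and $\xi_1,\dots,\xi_n\sim P_\xi$ are all independent. An estimator $\hat f$ is, for every $n$, a measurable map sending the sample $\mathcal D_n$ to a function in $C([0,1]^d)$; it does not depend on $r$. Its adversarial risk at radius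 $r$ is $$R_A(\hat f,f)=\mathbb E_{\mathcal D_n,X}\Big[\sup_{x'\in[0,1]^d,\ \|x'-X\|\le r}|\hat f(x')-f(X)|^2\Big]\in[0,\infty],$$ where $X\sim P_X$ is independent of $\mathcal D_n$ and $\|\cdot\|$ is the Euclidean norm. **Theorem.** There is a function $f_{\mathrm{ill}}\in H^{d/2}([0,1]^d)$ with $\|f_{\mathrm{ill}}\|_{H^{d/2}([0,1]^d)}\le L$, depending only on $d$ and $L$, with the following property. Let $s>0$ (in particular, any $0<s\le d/2$) and $\sigma\ge 0$. Let $P_X$ have a Lebesgue density bounded between two positive constants on $[0,1]^d$, and let $P_\xi$ have mean zero and be $\sigma$-sub-Gaussian, i.e. $\mathbb E\,e^{\lambda\xi}\le e^{\lambda^2\sigma^2/2}$ for all $\lambda\in\mathbb R$. Let $r_0>0$. Then there do not exist an estimator $\hat f$ and a constant $M$ such that $$R_A(\hat f,f_{\mathrm{ill}})\le M\left(n^{-\frac{2s}{2s+d}}+r^{2\min(1,s)}\right)$$ for all $n\ge 1$ and all $r\in(0,r_0]$. -/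

import Mathlib

open MeasureTheory ProbabilityTheory
open scoped ENNReal NNReal FourierTransform

noncomputable section

/-- The closed unit cube `[0,1]^d`. -/
def unitCube (d : ℕ) : Set (EuclideanSpace ℝ (Fin d)) :=
  {x | ∀ i, x i ∈ Set.Icc (0 : ℝ) 1}

/-- The closed unit cube as a space, with the Euclidean distance inherited from `ℝ^d`. -/
abbrev UnitCube (d : ℕ) : Type := ↥(unitCube d)

/-- Lebesgue measure on the cube. -/
def cubeVolume (d : ℕ) : Measure (UnitCube d) :=
  (volume : Measure (EuclideanSpace ℝ (Fin d))).comap Subtype.val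

/-- The norm `‖g‖_{H^s(ℝ^d)} = (∫ (1 + |ξ|²)^s |ĝ(ξ)|² dξ)^{1/2}` of `g ∈ L²(ℝ^d)`, with value `∞`
when `g` is not in `H^s(ℝ^d)`; here `ĝ(ξ) = (2π)^{-d/2} ∫ g(x) e^{-i⟨x,ξ⟩} dx`.
Mathlib's `𝓕` on `L²` extends `𝓕 g (η) = ∫ g(x) e^{-2πi⟨x,η⟩} dx`, so that
`ĝ(ξ) = (2π)^{-d/2} 𝓕 g (ξ / 2π)`; the substitution `ξ = 2πη` turns the integral above into the
one below. -/
def sobolevNorm {d : ℕ} (s : ℝ)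
    (g : Lp ℂ 2 (volume : Measure (EuclideanSpace ℝ (Fin d)))) : ℝ≥0∞ :=
  (∫⁻ η : EuclideanSpace ℝ (Fin d),
    ENNReal.ofReal ((1 + (2 * Real.pi * ‖η‖) ^ 2) ^ s) *
      ‖(𝓕 g : Lp ℂ 2 (volume : Measure (EuclideanSpace ℝ (Fin d)))) η‖ₑ ^ 2) ^ (1 / 2 : ℝ)

/-- The quotient norm `‖f‖_{H^s([0,1]^d)}`: the infimum of `‖g‖_{H^s(ℝ^d)}` over all `g` that agree
with `f` almost everywhere on the cube. It is finite exactly when `f ∈ H^s([0,1]^d)`. -/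
def cubeSobolevNorm {d : ℕ} (s : ℝ) (f : UnitCube d → ℝ) : ℝ≥0∞ :=
  ⨅ (g : Lp ℂ 2 (volume : Measure (EuclideanSpace ℝ (Fin d))))
    (_ : ∀ᵐ x : UnitCube d ∂(cubeVolume d), g (x : EuclideanSpace ℝ (Fin d)) = (f x : ℂ)), sobolevNorm s g

/-- The Sobolev ball of radius `L` in `H^s([0,1]^d)`. -/
def sobolevBall (d : ℕ) (s L : ℝ) : Set (UnitCube d → ℝ) :=
  {f | cubeSobolevNorm s f ≤ ENNReal.ofReal L}

/-- Covariate laws: probability measures on the cube with a Lebesgue density that is bounded away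
from zero and infinity. -/
def IsCovariateLaw {d : ℕ} (μ : Measure (UnitCube d)) : Prop :=
  IsProbabilityMeasure μ ∧
    ∃ (p : UnitCube d → ℝ) (c C : ℝ), Measurable p ∧ 0 < c ∧ (∀ x, c ≤ p x ∧ p x ≤ C) ∧
      μ = (cubeVolume d).withDensity (fun x => ENNReal.ofReal (p x))

/-- Noise laws: centred `σ`-sub-Gaussian probability measures on `ℝ`. -/
def IsNoiseLaw (σ : ℝ≥0) (ν : Measure ℝ) : Prop :=
  IsProbabilityMeasure ν ∧ ∫ e, e ∂ν = 0 ∧ HasSubgaussianMGF (fun e : ℝ => e) (σ ^ 2) ν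

/-- A (non-randomized) estimator: for every sample size `n`, a measurable map from samples
`(X_i, Y_i)_{i < n}` to continuous functions on the cube. Measurability of all evaluations is
measurability for the Borel σ-algebra of the uniform norm, as the cube is compact and metrizable. -/
def IsEstimator {d : ℕ} (F : (n : ℕ) → (Fin n → UnitCube d × ℝ) → C(UnitCube d, ℝ)) : Prop :=
  ∀ (n : ℕ) (x : UnitCube d), Measurable fun D => F n D x

/-- The adversarial risk `E sup_{x' ∈ [0,1]^d, ‖x' - X‖ ≤ r} |F(D)(x') - f(X)|²`, where the sample
`D = (X_i, f(X_i) + ξ_i)_{i < n}` is built from independent `X_i ∼ μ` and `ξ_i ∼ ν`, and the test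
point `X ∼ μ` is independent of `D`. The variable `z` is the vector of pairs `(X_i, ξ_i)`. -/
def adversarialRisk {d n : ℕ} (μ : Measure (UnitCube d)) (ν : Measure ℝ) (r : ℝ)
    (F : (Fin n → UnitCube d × ℝ) → C(UnitCube d, ℝ)) (f : UnitCube d → ℝ) : ℝ≥0∞ :=
  ∫⁻ z, ∫⁻ x, ⨆ x' ∈ Metric.closedBall x r,
      ENNReal.ofReal ((F (fun i => ((z i).1, f (z i).1 + (z i).2)) x' - f x) ^ 2) ∂μ
    ∂(Measure.pi fun _ : Fin n => μ.prod ν)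

end

/-!
The ill-posed function is a pile of Gaussians `f = ∑ k, c k * exp (-π ‖4 ^ k x‖²)` with
`∑ c k ^ 2` small but `∑ c k = ∞`, so that `f` tends to `∞` at the origin. The Fourier transforms of
the Gaussians are probability densities, concentrated at the scales `4 ^ k`, whose sum times the
Sobolev weight of order `d / 2` is bounded; by Cauchy–Schwarz the `H^{d/2}` norm of `f` is
therefore controlled by `∑ c k ^ 2`.

Letting `r → 0` with `n → ∞`, the conjectured bound makes the estimator consistent in `L²`. Within
distance `r` of the origin it then takes arbitrarily large values, while `f` stays below a constant
on a nearby set of positive measure. On that set the adversary can force an arbitrarily large error,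
so the adversarial risk at each fixed radius tends to `∞`.
-/

open Filter Topology

section AdversarialLoss

variable {X Y ι : Type*}

theorem iInf_mul_measure_le_lintegral [MeasurableSpace X] (μ : Measure X) {A : Set X}
    (hA : MeasurableSet A) (u : X → ℝ≥0∞) : (⨅ x ∈ A, u x) * μ A ≤ ∫⁻ x, u x ∂μ := by
  rw [← setLIntegral_const]
  exact (setLIntegral_mono' hA fun x hx => iInf₂_le (f := fun y _ => u y) x hx).trans
    (setLIntegral_le_lintegral _ _)

theorem mul_measure_le_lintegral_add_mul_lintegral [MeasurableSpace X] [MeasurableSpace Y]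
    {μ : Measure X} {ν : Measure Y} {B : Set X} {A : Set Y} (hB : MeasurableSet B)
    (hA : MeasurableSet A) (hA0 : ν A ≠ 0) (hA1 : ν A ≠ ∞) {u : X → ℝ≥0∞} {v : Y → ℝ≥0∞}
    {κ : ℝ≥0∞} (h : ∀ x ∈ B, ∀ y ∈ A, κ ≤ u x + v y) :
    κ * μ B ≤ ∫⁻ x, u x ∂μ + μ B / ν A * ∫⁻ y, v y ∂ν := by
  have hv : ⨅ y ∈ A, v y ≤ (∫⁻ y, v y ∂ν) / ν A :=
    (ENNReal.le_div_iff_mul_le (.inl hA0) (.inl hA1)).2 (iInf_mul_measure_le_lintegral ν hA v)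
  calc κ * μ B ≤ ((⨅ x ∈ B, u x) + ⨅ y ∈ A, v y) * μ B := by
        gcongr
        exact ENNReal.le_iInf₂_add_iInf₂ h
    _ ≤ ((⨅ x ∈ B, u x) + (∫⁻ y, v y ∂ν) / ν A) * μ B := by gcongr
    _ = (⨅ x ∈ B, u x) * μ B + μ B / ν A * ∫⁻ y, v y ∂ν := by
        simp only [div_eq_mul_inv]
        ring
    _ ≤ _ := by
        gcongr
        exact iInf_mul_measure_le_lintegral μ hB u

theorem tendsto_nhds_top_of_le_add_mul {l : Filter ι} {a b : ι → ℝ≥0∞} (hb : Tendsto b l (𝓝 0))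
    (h : ∀ T : ℝ≥0, ∃ C : ℝ≥0∞, C ≠ ∞ ∧ ∀ i, T ≤ a i + C * b i) : Tendsto a l (𝓝 ∞) := by
  refine ENNReal.tendsto_nhds_top_iff_nnreal.2 fun T => ?_
  obtain ⟨C, hC, hle⟩ := h (T + 1)
  have hCb : Tendsto (fun i => C * b i) l (𝓝 0) := by
    simpa only [mul_zero] using ENNReal.Tendsto.const_mul hb (.inr hC)
  filter_upwards [hCb.eventually_lt_const one_pos] with i hi
  by_contra! ha
  refine (hle i).not_gt ?_
  push_cast
  exact ENNReal.add_lt_add_of_le_of_lt (ha.trans_lt ENNReal.coe_lt_top).ne ha hi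

theorem exists_measure_inter_le_ne_zero [MeasurableSpace X] {μ : Measure X} {S : Set X}
    (hS : μ S ≠ 0) (f : X → ℝ) : ∃ c : ℝ, μ (S ∩ {x | f x ≤ c}) ≠ 0 := by
  have hunion : ⋃ n : ℕ, S ∩ {x | f x ≤ n} = S := by
    rw [← Set.inter_iUnion, Set.inter_eq_left]
    exact fun x _ => Set.mem_iUnion.2 (exists_nat_ge (f x))
  rw [← hunion] at hS
  obtain ⟨n, hn⟩ := exists_measure_pos_of_not_measure_iUnion_null hS
  exact ⟨n, hn.ne'⟩

/-- The adversarial risk at radius `r` of a fixed predictor `g`, that is, before averaging over the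
sample: the mean over `x ∼ μ` of the worst squared error `(g x' - f x) ^ 2` with `dist x' x ≤ r`. -/
noncomputable def adversarialLoss [PseudoMetricSpace X] [MeasurableSpace X] (μ : Measure X) (r : ℝ)
    (g f : X → ℝ) : ℝ≥0∞ :=
  ∫⁻ x, ⨆ x' ∈ Metric.closedBall x r, ENNReal.ofReal ((g x' - f x) ^ 2) ∂μ

theorem adversarialLoss_mono [PseudoMetricSpace X] [MeasurableSpace X] (μ : Measure X)
    (g f : X → ℝ) : Monotone fun r => adversarialLoss μ r g f := fun _ _ h =>
  lintegral_mono fun _ => biSup_mono fun _ hx' => Metric.closedBall_subset_closedBall h hx'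

variable [MetricSpace X] [MeasurableSpace X] {μ : Measure X} {f : X → ℝ}

theorem adversarialLoss_zero (μ : Measure X) (g f : X → ℝ) :
    adversarialLoss μ 0 g f = ∫⁻ x, ENNReal.ofReal ((g x - f x) ^ 2) ∂μ := by
  simp only [adversarialLoss, Metric.closedBall_zero, Set.mem_singleton_iff, iSup_iSup_eq_left]

theorem ofReal_mul_measure_le_adversarialLoss_add [IsFiniteMeasure μ] (g : X → ℝ) {A B : Set X}
    (hA : MeasurableSet A) (hB : MeasurableSet B) (hA0 : μ A ≠ 0) {r c t : ℝ} (ht : 0 ≤ t)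
    (hAB : ∀ x ∈ B, ∀ y ∈ A, dist y x ≤ r) (hfA : ∀ y ∈ A, c + t ≤ f y) (hfB : ∀ x ∈ B, f x ≤ c) :
    ENNReal.ofReal (t ^ 2 / 2) * μ B ≤
      adversarialLoss μ r g f + μ B / μ A * adversarialLoss μ 0 g f := by
  rw [adversarialLoss_zero]
  refine mul_measure_le_lintegral_add_mul_lintegral hB hA hA0 (measure_ne_top μ A)
    fun x hx y hy => ?_
  have hgap : t ^ 2 / 2 ≤ (g y - f x) ^ 2 + (g y - f y) ^ 2 := by
    have hsq : t ^ 2 ≤ (f y - f x) ^ 2 :=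
      pow_le_pow_left₀ ht (by linarith [hfA y hy, hfB x hx]) 2
    nlinarith [sq_nonneg ((g y - f x) + (g y - f y))]
  calc ENNReal.ofReal (t ^ 2 / 2)
      ≤ ENNReal.ofReal ((g y - f x) ^ 2) + ENNReal.ofReal ((g y - f y) ^ 2) := by
        rw [← ENNReal.ofReal_add (sq_nonneg _) (sq_nonneg _)]
        exact ENNReal.ofReal_le_ofReal hgap
    _ ≤ _ := by
        gcongr
        exact le_iSup₂_of_le y (hAB x hx y hy) le_rfl

theorem measurable_adversarialLoss_zero {Ω : Type*} [MeasurableSpace Ω] [SFinite μ]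
    {G : Ω → X → ℝ} (hG : Measurable (Function.uncurry G)) (hf : Measurable f) :
    Measurable fun ω => adversarialLoss μ 0 (G ω) f := by
  simp only [adversarialLoss_zero]
  exact ((hG.sub (hf.comp measurable_snd)).pow_const 2).ennreal_ofReal.lintegral_prod_right'

theorem le_lintegral_adversarialLoss_add [IsFiniteMeasure μ] {Ω : Type*} [MeasurableSpace Ω]
    {P : Measure Ω} [IsProbabilityMeasure P] {G : Ω → X → ℝ}
    (hG : Measurable (Function.uncurry G)) (hf : Measurable f) {r : ℝ} {κ C : ℝ≥0∞}
    (h : ∀ g : X → ℝ, κ ≤ adversarialLoss μ r g f + C * adversarialLoss μ 0 g f) :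
    κ ≤ ∫⁻ ω, adversarialLoss μ r (G ω) f ∂P + C * ∫⁻ ω, adversarialLoss μ 0 (G ω) f ∂P := by
  have hmeas := measurable_adversarialLoss_zero (μ := μ) hG hf
  rw [← lintegral_const_mul _ hmeas, ← lintegral_add_right _ (hmeas.const_mul C)]
  calc κ = ∫⁻ _, κ ∂P := by rw [lintegral_const, measure_univ, mul_one]
    _ ≤ _ := lintegral_mono fun ω => h (G ω)

theorem exists_le_adversarialLoss_add_mul [OpensMeasurableSpace X] [IsFiniteMeasure μ] {x₀ : X}
    (hf : Measurable f) (hunbdd : ∀ K : ℝ, ∃ᶠ x in 𝓝 x₀ ⊓ ae μ, K ≤ f x) {r : ℝ} (hr : 0 < r)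
    (T : ℝ≥0) :
    ∃ C : ℝ≥0∞, C ≠ ∞ ∧
      ∀ g : X → ℝ, T ≤ adversarialLoss μ r g f + C * adversarialLoss μ 0 g f := by
  set U := Metric.ball x₀ (r / 2)
  have hU : MeasurableSet U := Metric.isOpen_ball.measurableSet
  have hUf (K : ℝ) : μ (U ∩ {x | K ≤ f x}) ≠ 0 := by
    refine fun h0 => hunbdd K ?_
    filter_upwards [inter_mem_inf (Metric.ball_mem_nhds x₀ (half_pos hr))
      (measure_eq_zero_iff_ae_notMem.1 h0)] with x hx hK using hx.2 ⟨hx.1, hK⟩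
  obtain ⟨c, hc⟩ : ∃ c : ℝ, μ (U ∩ {x | f x ≤ c}) ≠ 0 :=
    exists_measure_inter_le_ne_zero
      (fun h0 => hUf 0 (measure_mono_null Set.inter_subset_left h0)) f
  set B := U ∩ {x | f x ≤ c}
  have hB : MeasurableSet B := hU.inter (hf measurableSet_Iic)
  obtain ⟨t, ht, hT⟩ : ∃ t : ℝ, 0 ≤ t ∧ T ≤ ENNReal.ofReal (t ^ 2 / 2) * μ B := by
    have hTB : T / μ B ≠ ∞ := ENNReal.div_ne_top ENNReal.coe_ne_top hc
    refine ⟨(T / μ B).toReal + 2, by positivity, ?_⟩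
    rw [← ENNReal.div_le_iff_le_mul (.inl hc) (.inl (measure_ne_top μ B))]
    refine (ENNReal.le_ofReal_iff_toReal_le hTB (by positivity)).2 ?_
    nlinarith [sq_nonneg (T / μ B).toReal, (T / μ B).toReal_nonneg]
  set A := U ∩ {x | c + t ≤ f x}
  have hA : MeasurableSet A := hU.inter (hf measurableSet_Ici)
  refine ⟨μ B / μ A, ENNReal.div_ne_top (measure_ne_top μ B) (hUf _), fun g => hT.trans ?_⟩
  refine ofReal_mul_measure_le_adversarialLoss_add g hA hB (hUf _) ht (fun x hx y hy => ?_)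
    (fun y hy => hy.2) fun x hx => hx.2
  linarith [dist_triangle_right y x x₀, Metric.mem_ball.1 hx.1, Metric.mem_ball.1 hy.1]

theorem tendsto_lintegral_adversarialLoss_top [OpensMeasurableSpace X] [IsFiniteMeasure μ]
    {x₀ : X} {l : Filter ι} {Ω : ι → Type*} [∀ i, MeasurableSpace (Ω i)]
    {P : ∀ i, Measure (Ω i)} [∀ i, IsProbabilityMeasure (P i)] {G : ∀ i, Ω i → X → ℝ}
    (hG : ∀ i, Measurable (Function.uncurry (G i))) (hf : Measurable f)
    (hunbdd : ∀ K : ℝ, ∃ᶠ x in 𝓝 x₀ ⊓ ae μ, K ≤ f x)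
    (hconv : Tendsto (fun i => ∫⁻ ω, adversarialLoss μ 0 (G i ω) f ∂P i) l (𝓝 0))
    {r : ℝ} (hr : 0 < r) :
    Tendsto (fun i => ∫⁻ ω, adversarialLoss μ r (G i ω) f ∂P i) l (𝓝 ∞) :=
  tendsto_nhds_top_of_le_add_mul hconv fun T =>
    let ⟨C, hC, hle⟩ := exists_le_adversarialLoss_add_mul hf hunbdd hr T
    ⟨C, hC, fun i => le_lintegral_adversarialLoss_add (hG i) hf hle⟩

end AdversarialLoss

section Lp

variable {ι α E F V : Type*}

theorem norm_toLp_two_sq [MeasurableSpace α] {μ : Measure α} [NormedAddCommGroup E] {f : α → E}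
    (hf : MemLp f 2 μ) : ‖hf.toLp f‖ ^ 2 = ∫ x, ‖f x‖ ^ 2 ∂μ := by
  rw [Lp.norm_toLp, toReal_eLpNorm hf.1,
    lpNorm_eq_integral_norm_rpow_toReal two_ne_zero ENNReal.ofNat_ne_top hf.1, ENNReal.toReal_ofNat]
  simp only [Real.rpow_two]
  exact Real.rpow_inv_natCast_pow (integral_nonneg fun x => sq_nonneg _) two_ne_zero

theorem ae_hasSum_tsum_toLp [Countable ι] [MeasurableSpace α] {μ : Measure α}
    [NormedAddCommGroup E] [CompleteSpace E] {p : ℝ≥0∞} [Fact (1 ≤ p)] {f : ι → α → E}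
    (hf : ∀ i, MemLp (f i) p μ) (hsum : Summable fun i => ‖(hf i).toLp‖) :
    ∀ᵐ x ∂μ, HasSum (fun i => f i x) ((∑' i, (hf i).toLp : Lp E p μ) x) := by
  have hcoe : ∀ᵐ x ∂μ, ∀ i, (hf i).toLp (f i) x = f i x :=
    ae_all_iff.2 fun i => (hf i).coeFn_toLp
  filter_upwards [Lp.hasSum_coeFn_tsum (tsum_enorm_ne_top_iff_summable_norm.2 hsum), hcoe]
    with x hx hxf
  simpa only [hxf] using hx

variable [NormedAddCommGroup V] [InnerProductSpace ℝ V] [FiniteDimensional ℝ V]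
  [MeasurableSpace V] [BorelSpace V] [NormedAddCommGroup F] [InnerProductSpace ℂ F]
  [CompleteSpace F]

open SchwartzMap in
theorem fourier_toLp_of_integrable {f : V → F} (hf₁ : Integrable f) (hf₂ : MemLp f 2)
    (hFf : MemLp (𝓕 f) 2) : 𝓕 (hf₂.toLp f) = hFf.toLp (𝓕 f) := by
  have hinj := LinearMap.ker_eq_bot.1
    (Lp.ker_toTemperedDistributionCLM_eq_bot (E := V) (F := F) (μ := volume) (p := 2))
  apply hinj
  change ((𝓕 (hf₂.toLp f) : Lp F 2 (volume : Measure V)) : 𝓢'(V, F)) =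
    ((hFf.toLp (𝓕 f) : Lp F 2 (volume : Measure V)) : 𝓢'(V, F))
  rw [← Lp.fourier_toTemperedDistribution_eq]
  ext φ
  rw [TemperedDistribution.fourier_apply, Lp.toTemperedDistribution_apply,
    Lp.toTemperedDistribution_apply]
  calc ∫ x, (𝓕 φ) x • (hf₂.toLp f) x = ∫ x, (𝓕 φ) x • f x :=
        integral_congr_ae (hf₂.coeFn_toLp.mono fun x hx => by simp only [hx])
    _ = ∫ x, φ x • (𝓕 f) x := by
        have hflip := VectorFourier.integral_fourierIntegral_smul_eq_flip (L := innerₗ V)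
          Real.continuous_fourierChar continuous_inner (φ.integrable (μ := volume)) hf₁
        rwa [flip_innerₗ] at hflip
    _ = ∫ x, φ x • (hFf.toLp (𝓕 f)) x :=
        integral_congr_ae (hFf.coeFn_toLp.mono fun x hx => by simp only [hx])

theorem ae_hasSum_fourier_tsum_toLp [Countable ι] {f : ι → V → F}
    (hf₁ : ∀ i, Integrable (f i)) (hf₂ : ∀ i, MemLp (f i) 2) (hFf : ∀ i, MemLp (𝓕 (f i)) 2)
    (hsum : Summable fun i => ‖(hf₂ i).toLp‖) :
    ∀ᵐ η, HasSum (fun i => 𝓕 (f i) η)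
      ((𝓕 (∑' i, (hf₂ i).toLp) : Lp F 2 (volume : Measure V)) η) := by
  have hterm (i : ι) : 𝓕 (hf₂ i).toLp = (hFf i).toLp := fourier_toLp_of_integrable (hf₁ i) _ _
  have htsum : 𝓕 (∑' i, (hf₂ i).toLp) = ∑' i, (hFf i).toLp :=
    ((Lp.fourierTransformₗᵢ V F).toContinuousLinearEquiv.map_tsum
      (L := SummationFilter.unconditional ι) (f := fun i => (hf₂ i).toLp)).trans (tsum_congr hterm)
  rw [htsum]
  refine ae_hasSum_tsum_toLp hFf ?_
  simpa only [← hterm, Lp.norm_fourier_eq] using hsum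

end Lp

section Schur

variable {ι α E : Type*}

theorem tsum_mul_sq_le_tsum_mul_tsum (c φ : ι → ℝ≥0∞) :
    (∑' i, φ i * c i) ^ 2 ≤ (∑' i, φ i) * ∑' i, φ i * c i ^ 2 := by
  have hfin (s : Finset ι) :
      (∑ i ∈ s, φ i * c i) ^ 2 ≤ (∑' i, φ i) * ∑' i, φ i * c i ^ 2 := by
    calc (∑ i ∈ s, φ i * c i) ^ 2
        ≤ ((∑ i ∈ s, φ i) ^ (1 - 2⁻¹ : ℝ) * (∑ i ∈ s, φ i * c i ^ (2 : ℝ)) ^ (2⁻¹ : ℝ)) ^ 2 := by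
          gcongr
          exact ENNReal.inner_le_weight_mul_Lp_of_nonneg s one_le_two φ c
      _ = (∑ i ∈ s, φ i) * ∑ i ∈ s, φ i * c i ^ 2 := by
          simp only [mul_pow, ← ENNReal.rpow_mul_natCast, ENNReal.rpow_two]
          norm_num
      _ ≤ _ := by gcongr <;> exact ENNReal.sum_le_tsum s
  exact le_of_tendsto' ((ENNReal.continuous_pow 2).continuousAt.tendsto.comp
    ENNReal.summable.hasSum) hfin

theorem lintegral_mul_enorm_sq_le_of_ae_hasSum [Countable ι] [MeasurableSpace α] {μ : Measure α}
    [NormedAddCommGroup E] {w : α → ℝ≥0∞} {φ : ι → α → ℝ≥0∞} {c : ι → ℝ≥0∞} {C : ℝ≥0∞}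
    {h : ι → α → E} {g : α → E} (hφ : ∀ i, AEMeasurable (φ i) μ)
    (hw : ∀ x, w x * ∑' i, φ i x ≤ C) (hle : ∀ i x, ‖h i x‖ₑ ≤ φ i x * c i)
    (hg : ∀ᵐ x ∂μ, HasSum (fun i => h i x) (g x)) :
    ∫⁻ x, w x * ‖g x‖ₑ ^ 2 ∂μ ≤ C * ∑' i, (∫⁻ x, φ i x ∂μ) * c i ^ 2 := by
  have hpointwise : ∀ᵐ x ∂μ, w x * ‖g x‖ₑ ^ 2 ≤ C * ∑' i, φ i x * c i ^ 2 := by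
    filter_upwards [hg] with x hx
    calc w x * ‖g x‖ₑ ^ 2
        ≤ w x * (∑' i, φ i x * c i) ^ 2 := by
          gcongr
          exact hx.tsum_eq ▸ enorm_tsum_le_tsum_enorm.trans
            (ENNReal.tsum_le_tsum fun i => hle i x)
      _ ≤ w x * ((∑' i, φ i x) * ∑' i, φ i x * c i ^ 2) := by
          gcongr
          exact tsum_mul_sq_le_tsum_mul_tsum c fun i => φ i x
      _ ≤ C * ∑' i, φ i x * c i ^ 2 := by
          rw [← mul_assoc]
          gcongr
          exact hw x
  have hmeas (i : ι) : AEMeasurable (fun x => φ i x * c i ^ 2) μ := (hφ i).mul_const _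
  calc ∫⁻ x, w x * ‖g x‖ₑ ^ 2 ∂μ
      ≤ ∫⁻ x, C * ∑' i, φ i x * c i ^ 2 ∂μ := lintegral_mono_ae hpointwise
    _ = C * ∑' i, (∫⁻ x, φ i x ∂μ) * c i ^ 2 := by
        rw [lintegral_const_mul'' _ (AEMeasurable.tsum hmeas), lintegral_tsum hmeas]
        simp only [lintegral_mul_const'' _ (hφ _)]

end Schur

section ScaledGaussian

variable {V : Type*} [NormedAddCommGroup V]

/-- The Gaussian `exp (-π ‖t x‖²)` of unit height and width `1 / t`. -/
noncomputable def scaledGaussian (t : ℝ) (x : V) : ℝ :=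
  Real.exp (-(Real.pi * t ^ 2) * ‖x‖ ^ 2)

theorem scaledGaussian_pos (t : ℝ) (x : V) : 0 < scaledGaussian t x := Real.exp_pos _

theorem scaledGaussian_sq_le (t : ℝ) (x : V) : scaledGaussian t x ^ 2 ≤ scaledGaussian t x := by
  refine pow_le_of_le_one (scaledGaussian_pos t x).le (Real.exp_le_one_iff.2 ?_) two_ne_zero
  rw [neg_mul, neg_nonpos]
  positivity

theorem continuous_scaledGaussian (t : ℝ) : Continuous (scaledGaussian t : V → ℝ) := by
  unfold scaledGaussian
  fun_prop

variable [InnerProductSpace ℝ V]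

/-- The density with respect to Lebesgue measure of a centred isotropic Gaussian law of width
proportional to `t`. It is the Fourier transform of `scaledGaussian t`. -/
noncomputable def gaussianDensity (t : ℝ) (η : V) : ℝ :=
  t⁻¹ ^ Module.finrank ℝ V * scaledGaussian t⁻¹ η

theorem gaussianDensity_nonneg {t : ℝ} (ht : 0 ≤ t) (η : V) : 0 ≤ gaussianDensity t η :=
  mul_nonneg (pow_nonneg (inv_nonneg.2 ht) _) (scaledGaussian_pos _ _).le

theorem continuous_gaussianDensity (t : ℝ) : Continuous (gaussianDensity t : V → ℝ) :=
  (continuous_scaledGaussian t⁻¹).const_mul _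

variable [FiniteDimensional ℝ V] [MeasurableSpace V] [BorelSpace V] {t : ℝ}

theorem integral_scaledGaussian (ht : 0 < t) :
    ∫ x : V, scaledGaussian t x = t⁻¹ ^ Module.finrank ℝ V := by
  have hbase : Real.pi / (Real.pi * t ^ 2) = t⁻¹ ^ 2 := by field_simp
  simp only [scaledGaussian]
  rw [GaussianFourier.integral_rexp_neg_mul_sq_norm (by positivity), hbase,
    Real.rpow_div_two_eq_sqrt _ (by positivity), Real.sqrt_sq (by positivity), Real.rpow_natCast]

theorem integrable_scaledGaussian (ht : 0 < t) : Integrable (scaledGaussian t : V → ℝ) :=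
  .of_integral_ne_zero (by rw [integral_scaledGaussian ht]; positivity)

theorem memLp_two_scaledGaussian (ht : 0 < t) : MemLp (scaledGaussian t : V → ℝ) 2 :=
  (memLp_two_iff_integrable_sq (continuous_scaledGaussian t).aestronglyMeasurable).2 <|
    (integrable_scaledGaussian ht).mono'
      ((continuous_scaledGaussian t).pow 2).aestronglyMeasurable <| .of_forall fun x =>
        (Real.norm_of_nonneg (sq_nonneg _)).trans_le (scaledGaussian_sq_le t x)

theorem memLp_two_gaussianDensity (ht : 0 < t) : MemLp (gaussianDensity t : V → ℝ) 2 :=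
  (memLp_two_scaledGaussian (inv_pos.2 ht)).const_mul _

theorem lintegral_gaussianDensity (ht : 0 < t) :
    ∫⁻ η : V, ENNReal.ofReal (gaussianDensity t η) = 1 := by
  have hint : Integrable (gaussianDensity t : V → ℝ) :=
    (integrable_scaledGaussian (inv_pos.2 ht)).const_mul _
  rw [← ofReal_integral_eq_lintegral_ofReal hint
    (.of_forall fun η => gaussianDensity_nonneg ht.le η)]
  simp only [gaussianDensity]
  rw [integral_const_mul, integral_scaledGaussian (inv_pos.2 ht), ← mul_pow,
    mul_inv_cancel₀ (inv_ne_zero ht.ne'), one_pow, ENNReal.ofReal_one]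

theorem fourier_scaledGaussian (ht : 0 < t) :
    𝓕 (fun x : V => (scaledGaussian t x : ℂ)) = fun η => (gaussianDensity t η : ℂ) := by
  have hbase : (Real.pi : ℂ) / ((Real.pi * t ^ 2 : ℝ) : ℂ) = ((t⁻¹ ^ 2 : ℝ) : ℂ) := by
    push_cast
    field_simp
  have hscaled : (fun x : V => (scaledGaussian t x : ℂ)) =
      fun x => Complex.exp (-((Real.pi * t ^ 2 : ℝ) : ℂ) * ‖x‖ ^ 2) := by
    funext x
    simp only [scaledGaussian, Complex.ofReal_exp, Complex.ofReal_mul, Complex.ofReal_neg,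
      Complex.ofReal_pow]
  funext η
  rw [hscaled, fourier_gaussian_innerProductSpace (by rw [Complex.ofReal_re]; positivity),
    hbase, gaussianDensity, Complex.ofReal_mul (t⁻¹ ^ Module.finrank ℝ V)]
  congr 1
  · have hexp : (Module.finrank ℝ V / 2 : ℂ) = ((Module.finrank ℝ V / 2 : ℝ) : ℂ) := by
      push_cast
      rfl
    rw [hexp, ← Complex.ofReal_cpow (by positivity),
      Real.rpow_div_two_eq_sqrt _ (by positivity), Real.sqrt_sq (by positivity), Real.rpow_natCast]
  · rw [scaledGaussian, Complex.ofReal_exp]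
    congr 1
    push_cast
    field_simp

theorem norm_toLp_scaledGaussian_sq_le (ht : 0 < t) :
    ‖(memLp_two_scaledGaussian ht).ofReal.toLp (fun x : V => (scaledGaussian t x : ℂ))‖ ^ 2 ≤
      t⁻¹ ^ Module.finrank ℝ V := by
  rw [norm_toLp_two_sq, ← integral_scaledGaussian ht]
  simp only [Complex.norm_real, Real.norm_eq_abs, sq_abs]
  exact integral_mono (memLp_two_scaledGaussian ht).integrable_sq (integrable_scaledGaussian ht)
    fun x => scaledGaussian_sq_le t x

end ScaledGaussian

section GaussianWeight

theorem one_add_pow_mul_exp_neg_mul_sq_le (n : ℕ) {b u : ℝ} (hb : 0 < b) (hu : 0 ≤ u) :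
    (1 + u) ^ n * Real.exp (-(b * u ^ 2)) ≤ n.factorial * Real.exp (1 + (4 * b)⁻¹) := by
  have hpow : (1 + u) ^ n ≤ n.factorial * Real.exp (1 + u) := by
    rw [mul_comm, ← div_le_iff₀ (by positivity)]
    exact Real.pow_div_factorial_le_exp (1 + u) (by positivity) n
  have hexp : 1 + u - b * u ^ 2 ≤ 1 + (4 * b)⁻¹ := by
    have hsq : (4 * b)⁻¹ - u + b * u ^ 2 = b * (u - (2 * b)⁻¹) ^ 2 := by
      field_simp
      ring
    linarith [mul_nonneg hb.le (sq_nonneg (u - (2 * b)⁻¹))]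
  calc (1 + u) ^ n * Real.exp (-(b * u ^ 2))
      ≤ n.factorial * Real.exp (1 + u) * Real.exp (-(b * u ^ 2)) := by gcongr
    _ = n.factorial * Real.exp (1 + u - b * u ^ 2) := by rw [mul_assoc, ← Real.exp_add]; rfl
    _ ≤ n.factorial * Real.exp (1 + (4 * b)⁻¹) := by gcongr

-- The right-hand side telescopes along the geometric sequence `u / q ^ k`.
theorem exists_pow_mul_exp_neg_mul_sq_le {d : ℕ} (hd : d ≠ 0) {b q : ℝ} (hb : 0 < b)
    (hq : 1 < q) : ∃ C : ℝ, 0 ≤ C ∧ ∀ u : ℝ, 0 < u →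
      u ^ d * Real.exp (-(b * u ^ 2)) ≤ C * (u / (1 + u) - u / q / (1 + u / q)) := by
  obtain ⟨m, rfl⟩ := Nat.exists_eq_succ_of_ne_zero hd
  have hq1 : 0 < q - 1 := sub_pos.2 hq
  set A : ℝ := (m + 2).factorial * Real.exp (1 + (4 * b)⁻¹)
  refine ⟨A * q / (q - 1), by positivity, fun u hu => ?_⟩
  have hdiff : A * q / (q - 1) * (u / (1 + u) - u / q / (1 + u / q)) =
      A * (q * u) / ((1 + u) * (q + u)) := by
    field_simp
    ring
  have hqu : q + u ≤ q * (1 + u) := by nlinarith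
  rw [hdiff, le_div_iff₀ (by positivity)]
  calc u ^ (m + 1) * Real.exp (-(b * u ^ 2)) * ((1 + u) * (q + u))
      = u ^ m * u * Real.exp (-(b * u ^ 2)) * ((1 + u) * (q + u)) := by rw [pow_succ]
    _ ≤ (1 + u) ^ m * u * Real.exp (-(b * u ^ 2)) * ((1 + u) * (q * (1 + u))) := by
        gcongr
        linarith
    _ = (1 + u) ^ (m + 2) * Real.exp (-(b * u ^ 2)) * (q * u) := by ring
    _ ≤ A * (q * u) := by
        gcongr
        exact one_add_pow_mul_exp_neg_mul_sq_le (m + 2) hb hu.le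

theorem exists_sum_div_pow_mul_exp_le {d : ℕ} (hd : d ≠ 0) {b q : ℝ} (hb : 0 < b) (hq : 1 < q) :
    ∃ C : ℝ, ∀ u : ℝ, 0 < u → ∀ n : ℕ,
      ∑ k ∈ Finset.range n, (u / q ^ k) ^ d * Real.exp (-(b * (u / q ^ k) ^ 2)) ≤ C := by
  obtain ⟨C, hC, hle⟩ := exists_pow_mul_exp_neg_mul_sq_le hd hb hq
  refine ⟨C, fun u hu n => ?_⟩
  let ψ (k : ℕ) : ℝ := u / q ^ k / (1 + u / q ^ k)
  have hψ_nonneg (k : ℕ) : 0 ≤ ψ k := by positivity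
  have hψ_le_one : ψ 0 ≤ 1 := div_le_one_of_le₀ (le_add_of_nonneg_left zero_le_one) (by positivity)
  calc ∑ k ∈ Finset.range n, (u / q ^ k) ^ d * Real.exp (-(b * (u / q ^ k) ^ 2))
      ≤ ∑ k ∈ Finset.range n, C * (ψ k - ψ (k + 1)) := by
        refine Finset.sum_le_sum fun k _ => (hle _ (by positivity)).trans_eq ?_
        rw [div_div u (q ^ k) q, ← pow_succ]
    _ = C * (ψ 0 - ψ n) := by rw [← Finset.mul_sum, Finset.sum_range_sub']
    _ ≤ C := mul_le_of_le_one_right hC (by linarith [hψ_nonneg n])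

variable {V : Type*} [NormedAddCommGroup V] [InnerProductSpace ℝ V]

theorem rpow_mul_gaussianDensity_le {t : ℝ} (ht : 1 ≤ t) (η : V) :
    (1 + (2 * Real.pi * ‖η‖) ^ 2) ^ (Module.finrank ℝ V / 2 : ℝ) * gaussianDensity t η ≤
      Real.exp 1 * ((√(1 + (2 * Real.pi * ‖η‖) ^ 2) / t) ^ Module.finrank ℝ V *
        Real.exp (-((4 * Real.pi)⁻¹ * (√(1 + (2 * Real.pi * ‖η‖) ^ 2) / t) ^ 2))) := by
  have hexp : -(Real.pi * t⁻¹ ^ 2) * ‖η‖ ^ 2 ≤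
      1 + -((4 * Real.pi)⁻¹ * (√(1 + (2 * Real.pi * ‖η‖) ^ 2) / t) ^ 2) := by
    have hsplit : (4 * Real.pi)⁻¹ * (√(1 + (2 * Real.pi * ‖η‖) ^ 2) / t) ^ 2 =
        (4 * Real.pi * t ^ 2)⁻¹ + Real.pi * t⁻¹ ^ 2 * ‖η‖ ^ 2 := by
      rw [div_pow, Real.sq_sqrt (by positivity)]
      field_simp
      ring
    have hinv : (4 * Real.pi * t ^ 2)⁻¹ ≤ 1 :=
      inv_le_one_of_one_le₀ (one_le_mul_of_one_le_of_one_le (by linarith [Real.pi_gt_three])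
        (one_le_pow₀ ht))
    rw [hsplit]
    linarith
  rw [Real.rpow_div_two_eq_sqrt _ (by positivity), Real.rpow_natCast, gaussianDensity,
    ← mul_assoc, ← mul_pow, ← div_eq_mul_inv, mul_left_comm, ← Real.exp_add]
  gcongr
  exact Real.exp_le_exp.2 hexp

variable [FiniteDimensional ℝ V] [Nontrivial V]

theorem exists_mul_tsum_gaussianDensity_le :
    ∃ C : ℝ≥0, ∀ η : V,
      ENNReal.ofReal ((1 + (2 * Real.pi * ‖η‖) ^ 2) ^ (Module.finrank ℝ V / 2 : ℝ)) *
        ∑' k : ℕ, ENNReal.ofReal (gaussianDensity (4 ^ k) η) ≤ C := by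
  obtain ⟨C, hle⟩ := exists_sum_div_pow_mul_exp_le (Module.finrank_pos (R := ℝ) (M := V)).ne'
    (inv_pos.2 (mul_pos four_pos Real.pi_pos)) (Nat.one_lt_ofNat (α := ℝ) (n := 4))
  refine ⟨(Real.exp 1 * C).toNNReal, fun η => ?_⟩
  rw [ENNReal.tsum_eq_iSup_nat, ENNReal.mul_iSup]
  refine iSup_le fun n => ?_
  rw [← ENNReal.ofReal_sum_of_nonneg fun k _ => gaussianDensity_nonneg (by positivity) η,
    ← ENNReal.ofReal_mul (by positivity), Finset.mul_sum]
  refine ENNReal.ofReal_le_ofReal <| (Finset.sum_le_sum fun k _ =>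
    rpow_mul_gaussianDensity_le (one_le_pow₀ (Nat.one_le_ofNat (α := ℝ) (n := 4))) η).trans ?_
  rw [← Finset.mul_sum]
  gcongr
  exact hle _ (Real.sqrt_pos.2 (by positivity)) n

end GaussianWeight

theorem exists_tsum_sq_le_tendsto_sum_atTop {δ : ℝ} (hδ : 0 < δ) :
    ∃ c : ℕ → ℝ, (∀ k, 0 ≤ c k) ∧ Summable (fun k => c k ^ 2) ∧ ∑' k, c k ^ 2 ≤ δ ∧
      Tendsto (fun n => ∑ k ∈ Finset.range n, c k) atTop atTop := by
  have hsum : Summable fun k : ℕ => (1 / ((k : ℝ) + 1)) ^ 2 := by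
    simpa only [Nat.cast_add_one, one_div_pow]
      using (summable_nat_add_iff 1).2 (Real.summable_one_div_nat_pow.2 one_lt_two)
  let S : ℝ := ∑' k : ℕ, (1 / ((k : ℝ) + 1)) ^ 2
  have hε : 0 < √(δ / (S + 1)) := Real.sqrt_pos.2 (by positivity)
  refine ⟨fun k => √(δ / (S + 1)) * (1 / ((k : ℝ) + 1)), fun k => by positivity, ?_, ?_, ?_⟩
  · simpa only [mul_pow] using hsum.mul_left _
  · simp only [mul_pow, tsum_mul_left]
    rw [Real.sq_sqrt (by positivity), div_mul_eq_mul_div, div_le_iff₀ (by positivity)]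
    exact mul_le_mul_of_nonneg_left (le_add_of_nonneg_right zero_le_one) hδ.le
  · simpa only [← Finset.mul_sum]
      using Real.tendsto_sum_range_one_div_nat_succ_atTop.const_mul_atTop hε

section GaussianPile

variable {V : Type*} [NormedAddCommGroup V]

/-- The function `∑ k, c k * exp (-π ‖4 ^ k x‖²)`: Gaussians of heights `c k` on top of each other
at the origin, with geometrically shrinking widths. It is used with square-summable `c`; at points
where the series diverges, in particular possibly at the origin, the value is `0`. -/
noncomputable def gaussianPile (c : ℕ → ℝ) (x : V) : ℝ :=
  ∑' k, c k * scaledGaussian (4 ^ k) x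

theorem exp_neg_pi_le_scaledGaussian {t : ℝ} {x : V} (ht : 0 ≤ t) (hx : t * ‖x‖ ≤ 1) :
    Real.exp (-Real.pi) ≤ scaledGaussian t x := by
  refine Real.exp_le_exp.2 ?_
  rw [neg_mul, neg_le_neg_iff, mul_assoc, ← mul_pow]
  exact mul_le_of_le_one_right Real.pi_pos.le (pow_le_one₀ (by positivity) hx)

theorem measurable_gaussianPile [MeasurableSpace V] [BorelSpace V] (c : ℕ → ℝ) :
    Measurable (gaussianPile c : V → ℝ) :=
  Measurable.tsum fun k => ((continuous_scaledGaussian (4 ^ k)).const_mul (c k)).measurable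

variable [InnerProductSpace ℝ V] [FiniteDimensional ℝ V] [Nontrivial V] [MeasurableSpace V]
  [BorelSpace V] {c : ℕ → ℝ}

theorem summable_norm_smul_toLp_scaledGaussian (hc : Summable fun k => c k ^ 2) :
    Summable fun k => ‖(c k : ℂ) • (memLp_two_scaledGaussian (by positivity)).ofReal.toLp
      (fun x : V => (scaledGaussian (4 ^ k) x : ℂ))‖ := by
  let G (k : ℕ) : Lp ℂ 2 (volume : Measure V) :=
    (memLp_two_scaledGaussian (by positivity)).ofReal.toLp fun x => (scaledGaussian (4 ^ k) x : ℂ)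
  have hG (k : ℕ) : ‖G k‖ ^ 2 ≤ 4⁻¹ ^ k := by
    refine (norm_toLp_scaledGaussian_sq_le (by positivity)).trans ?_
    rw [inv_pow 4 k]
    exact pow_le_of_le_one (by positivity)
      (inv_le_one_of_one_le₀ (one_le_pow₀ (by norm_num))) Module.finrank_pos.ne'
  refine .of_nonneg_of_le (fun k => norm_nonneg _) (fun k => ?_)
    (hc.add (summable_geometric_of_lt_one (r := 4⁻¹) (by positivity) (by norm_num)))
  calc ‖(c k : ℂ) • G k‖ = |c k| * ‖G k‖ := by
        rw [norm_smul, Complex.norm_real, Real.norm_eq_abs]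
    _ ≤ |c k| ^ 2 + ‖G k‖ ^ 2 := by
        linarith [two_mul_le_add_sq |c k| ‖G k‖, mul_nonneg (abs_nonneg (c k)) (norm_nonneg (G k))]
    _ ≤ c k ^ 2 + 4⁻¹ ^ k := by
        rw [sq_abs]
        gcongr
        exact hG k

theorem exists_ae_hasSum_fourier_gaussianPile (hc : Summable fun k => c k ^ 2) :
    ∃ g : Lp ℂ 2 (volume : Measure V),
      (∀ᵐ x, HasSum (fun k => ((c k * scaledGaussian (4 ^ k) x : ℝ) : ℂ)) (g x)) ∧
      ∀ᵐ η, HasSum (fun k => ((c k * gaussianDensity (4 ^ k) η : ℝ) : ℂ))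
        ((𝓕 g : Lp ℂ 2 (volume : Measure V)) η) := by
  let f (k : ℕ) : V → ℂ := (c k : ℂ) • fun x => (scaledGaussian (4 ^ k) x : ℂ)
  have hf₁ (k : ℕ) : Integrable (f k) :=
    (integrable_scaledGaussian (by positivity)).ofReal.smul (c k : ℂ)
  have hf₂ (k : ℕ) : MemLp (f k) 2 :=
    (memLp_two_scaledGaussian (by positivity)).ofReal.const_smul (c k : ℂ)
  have hF (k : ℕ) : 𝓕 (f k) = (c k : ℂ) • fun η => (gaussianDensity (4 ^ k) η : ℂ) := by
    rw [← fourier_scaledGaussian (by positivity)]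
    exact VectorFourier.fourierIntegral_const_smul _ _ _ _ _
  have hFf (k : ℕ) : MemLp (𝓕 (f k)) 2 := by
    rw [hF]
    exact (memLp_two_gaussianDensity (by positivity)).ofReal.const_smul (c k : ℂ)
  have hsum : Summable fun k => ‖(hf₂ k).toLp‖ := summable_norm_smul_toLp_scaledGaussian hc
  refine ⟨∑' k, (hf₂ k).toLp, ?_, ?_⟩
  · simpa only [f, Pi.smul_apply, smul_eq_mul, ← Complex.ofReal_mul]
      using ae_hasSum_tsum_toLp hf₂ hsum
  · simpa only [hF, Pi.smul_apply, smul_eq_mul, ← Complex.ofReal_mul]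
      using ae_hasSum_fourier_tsum_toLp hf₁ hf₂ hFf hsum

theorem ae_hasSum_gaussianPile (hc : Summable fun k => c k ^ 2) :
    ∀ᵐ x : V, HasSum (fun k => c k * scaledGaussian (4 ^ k) x) (gaussianPile c x) := by
  obtain ⟨g, hg, -⟩ := exists_ae_hasSum_fourier_gaussianPile (V := V) hc
  filter_upwards [hg] with x hx
  exact (Complex.summable_ofReal.1 hx.summable).hasSum

theorem tendsto_gaussianPile_atTop (hc : Summable fun k => c k ^ 2) (hc0 : ∀ k, 0 ≤ c k)
    (hdiv : Tendsto (fun n => ∑ k ∈ Finset.range n, c k) atTop atTop) :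
    Tendsto (gaussianPile c) (𝓝 (0 : V) ⊓ ae volume) atTop := by
  refine tendsto_atTop.2 fun K => ?_
  obtain ⟨N, hN⟩ := ((hdiv.atTop_mul_const
    (Real.exp_pos (-Real.pi))).eventually_ge_atTop K).exists
  have hnear : ∀ᶠ x : V in 𝓝 0, 4 ^ N * ‖x‖ < 1 :=
    (continuous_norm.const_mul _).continuousAt.eventually_lt continuousAt_const (by simp)
  filter_upwards [mem_inf_of_left hnear, mem_inf_of_right (ae_hasSum_gaussianPile hc)]
    with x hx hsum
  have hbig (k : ℕ) (hk : k ∈ Finset.range N) :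
      Real.exp (-Real.pi) ≤ scaledGaussian (4 ^ k) x := by
    refine exp_neg_pi_le_scaledGaussian (by positivity) (le_trans ?_ hx.le)
    gcongr
    · norm_num
    · exact (Finset.mem_range.1 hk).le
  calc K ≤ (∑ k ∈ Finset.range N, c k) * Real.exp (-Real.pi) := hN
    _ = ∑ k ∈ Finset.range N, c k * Real.exp (-Real.pi) := Finset.sum_mul ..
    _ ≤ ∑ k ∈ Finset.range N, c k * scaledGaussian (4 ^ k) x :=
        Finset.sum_le_sum fun k hk => mul_le_mul_of_nonneg_left (hbig k hk) (hc0 k)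
    _ ≤ gaussianPile c x :=
        sum_le_hasSum _ (fun k _ => mul_nonneg (hc0 k) (scaledGaussian_pos _ x).le) hsum

variable (V) in
theorem exists_lintegral_fourier_gaussianPile_le :
    ∃ C : ℝ≥0, ∀ c : ℕ → ℝ, Summable (fun k => c k ^ 2) →
      ∃ g : Lp ℂ 2 (volume : Measure V), (∀ᵐ x, g x = gaussianPile c x) ∧
        ∫⁻ η : V,
          ENNReal.ofReal ((1 + (2 * Real.pi * ‖η‖) ^ 2) ^ (Module.finrank ℝ V / 2 : ℝ)) *
            ‖(𝓕 g : Lp ℂ 2 (volume : Measure V)) η‖ₑ ^ 2 ≤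
        C * ENNReal.ofReal (∑' k, c k ^ 2) := by
  obtain ⟨C, hC⟩ := exists_mul_tsum_gaussianDensity_le (V := V)
  refine ⟨C, fun c hc => ?_⟩
  obtain ⟨g, hg, hFg⟩ := exists_ae_hasSum_fourier_gaussianPile (V := V) hc
  refine ⟨g, hg.mono fun x hx => ?_, ?_⟩
  · rw [gaussianPile, Complex.ofReal_tsum, hx.tsum_eq]
  have hterm (k : ℕ) (η : V) : ‖((c k * gaussianDensity (4 ^ k) η : ℝ) : ℂ)‖ₑ ≤
      ENNReal.ofReal (gaussianDensity (4 ^ k) η) * ‖c k‖ₑ := by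
    rw [← ofReal_norm, Complex.norm_real, ofReal_norm, enorm_mul, mul_comm,
      Real.enorm_of_nonneg (gaussianDensity_nonneg (by positivity) η)]
  refine (lintegral_mul_enorm_sq_le_of_ae_hasSum (fun k =>
    (continuous_gaussianDensity (4 ^ k)).measurable.ennreal_ofReal.aemeasurable) hC hterm
    hFg).trans_eq ?_
  congr 1
  rw [ENNReal.ofReal_tsum_of_nonneg (fun k => sq_nonneg _) hc]
  refine tsum_congr fun k => ?_
  rw [lintegral_gaussianDensity (by positivity), one_mul, ← ofReal_norm,
    ← ENNReal.ofReal_pow (norm_nonneg _), Real.norm_eq_abs, sq_abs]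

end GaussianPile

section PositiveOnOpenSets

variable {X : Type*} [TopologicalSpace X] [MeasurableSpace X]

theorem nhds_inf_ae_neBot_of_mem_support {μ : Measure X} {x : X} (hx : x ∈ μ.support) :
    (𝓝 x ⊓ ae μ).NeBot := by
  refine inf_neBot_iff.2 fun s hs t ht => ?_
  have hfreq : ∃ᵐ y ∂μ, y ∈ s :=
    frequently_ae_mem_iff.2 ((Measure.mem_support_iff_forall x).1 hx s hs).ne'
  exact (hfreq.and_eventually ht).exists

theorem isOpenPosMeasure_comap_subtype_val (μ : Measure X) [μ.IsOpenPosMeasure]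
    {s : Set X} (hs : MeasurableSet s) (hcl : s ⊆ closure (interior s)) :
    (μ.comap (Subtype.val : s → X)).IsOpenPosMeasure := by
  refine ⟨fun U hU ⟨x, hx⟩ h0 => ?_⟩
  obtain ⟨O, hO, rfl⟩ := isOpen_induced_iff.1 hU
  have hne : (O ∩ interior s).Nonempty := mem_closure_iff.1 (hcl x.2) O hO hx
  refine (hO.inter isOpen_interior).measure_ne_zero μ hne (measure_mono_null ?_
    ((comap_subtype_coe_apply hs μ _).symm.trans h0))
  exact fun y hy => ⟨⟨y, interior_subset hy.2⟩, hy.1, rfl⟩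

end PositiveOnOpenSets

section UnitCube

variable {d : ℕ}

theorem unitCube_eq_preimage_pi (d : ℕ) :
    unitCube d = EuclideanSpace.equiv (Fin d) ℝ ⁻¹' Set.univ.pi fun _ => Set.Icc 0 1 := by
  ext x
  simp only [unitCube, Set.mem_ofPred_eq, Set.mem_preimage, Set.mem_univ_pi]
  rfl

theorem measurableSet_unitCube (d : ℕ) : MeasurableSet (unitCube d) := by
  rw [unitCube_eq_preimage_pi]
  exact ((isClosed_set_pi fun _ _ => isClosed_Icc).preimage
    (EuclideanSpace.equiv (Fin d) ℝ).continuous).measurableSet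

theorem unitCube_subset_closure_interior (d : ℕ) :
    unitCube d ⊆ closure (interior (unitCube d)) := by
  rw [unitCube_eq_preimage_pi, ← ContinuousLinearEquiv.coe_toHomeomorph,
    ← Homeomorph.preimage_interior, ← Homeomorph.preimage_closure,
    interior_pi_set Set.finite_univ, closure_pi_set]
  simp only [interior_Icc, closure_Ioo (zero_ne_one' ℝ), subset_rfl]

instance isOpenPosMeasure_cubeVolume : (cubeVolume d).IsOpenPosMeasure :=
  isOpenPosMeasure_comap_subtype_val _ (measurableSet_unitCube d)
    (unitCube_subset_closure_interior d)

theorem quasiMeasurePreserving_val_cubeVolume (d : ℕ) :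
    Measure.QuasiMeasurePreserving Subtype.val (cubeVolume d) volume := by
  refine ⟨measurable_subtype_coe, ?_⟩
  rw [cubeVolume, map_comap_subtype_coe (measurableSet_unitCube d)]
  exact Measure.absolutelyContinuous_restrict

theorem zero_mem_unitCube (d : ℕ) : 0 ∈ unitCube d := fun _ => Set.left_mem_Icc.2 zero_le_one

theorem exists_cubeSobolevNorm_gaussianPile_sq_le (d : ℕ) [NeZero d] :
    ∃ C : ℝ≥0, ∀ c : ℕ → ℝ, Summable (fun k => c k ^ 2) →
      cubeSobolevNorm (d / 2 : ℝ) (fun x : UnitCube d => gaussianPile c x.1) ^ 2 ≤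
        C * ENNReal.ofReal (∑' k, c k ^ 2) := by
  obtain ⟨C, hC⟩ := exists_lintegral_fourier_gaussianPile_le (EuclideanSpace ℝ (Fin d))
  refine ⟨C, fun c hc => ?_⟩
  obtain ⟨g, hg, hle⟩ := hC c hc
  have hnorm : cubeSobolevNorm (d / 2 : ℝ) (fun x : UnitCube d => gaussianPile c x.1) ≤
      sobolevNorm (d / 2 : ℝ) g :=
    iInf₂_le g ((quasiMeasurePreserving_val_cubeVolume d).ae hg)
  rw [finrank_euclideanSpace_fin] at hle
  refine (pow_le_pow_left' hnorm 2).trans ?_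
  rwa [sobolevNorm, ← ENNReal.rpow_mul_natCast, Nat.cast_ofNat, one_div_mul_cancel two_ne_zero,
    ENNReal.rpow_one]

theorem exists_mem_sobolevBall_tendsto_atTop (d : ℕ) [NeZero d] {L : ℝ} (hL : 0 < L) :
    ∃ f : UnitCube d → ℝ, Measurable f ∧ f ∈ sobolevBall d (d / 2) L ∧
      Tendsto f (𝓝 ⟨0, zero_mem_unitCube d⟩ ⊓ ae (cubeVolume d)) atTop := by
  obtain ⟨C, hC⟩ := exists_cubeSobolevNorm_gaussianPile_sq_le d
  obtain ⟨c, hc0, hc, hcL, hdiv⟩ :=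
    exists_tsum_sq_le_tendsto_sum_atTop (δ := L ^ 2 / (C + 1)) (by positivity)
  refine ⟨fun x => gaussianPile c x.1, (measurable_gaussianPile c).comp measurable_subtype_coe,
    ?_, (tendsto_gaussianPile_atTop hc hc0 hdiv).comp ?_⟩
  · refine (ENNReal.pow_le_pow_left_iff two_ne_zero).1 ((hC c hc).trans ?_)
    rw [← ENNReal.ofReal_coe_nnreal, ← ENNReal.ofReal_mul C.coe_nonneg, ← ENNReal.ofReal_pow hL.le]
    refine ENNReal.ofReal_le_ofReal ?_
    calc (C : ℝ) * ∑' k, c k ^ 2 ≤ (C + 1) * (L ^ 2 / (C + 1)) := by gcongr; linarith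
      _ = L ^ 2 := by field_simp
  · exact Tendsto.inf continuous_subtype_val.continuousAt
      (quasiMeasurePreserving_val_cubeVolume d).tendsto_ae

end UnitCube

section RateBounds

variable {p q M r₀ : ℝ} {R : ℕ → ℝ → ℝ≥0∞}

theorem tendsto_ofReal_mul_natCast_rpow_add_rpow (hp : p < 0) (hq : 0 < q) (M : ℝ) {r : ℕ → ℝ}
    {ρ : ℝ} (hr : Tendsto r atTop (𝓝 ρ)) :
    Tendsto (fun n : ℕ => ENNReal.ofReal (M * ((n : ℝ) ^ p + r n ^ q))) atTop
      (𝓝 (ENNReal.ofReal (M * ρ ^ q))) := by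
  have hn : Tendsto (fun n : ℕ => (n : ℝ) ^ p) atTop (𝓝 0) := by
    simpa only [neg_neg, Function.comp_def]
      using (tendsto_rpow_neg_atTop (neg_pos.2 hp)).comp tendsto_natCast_atTop_atTop
  simpa only [zero_add]
    using ENNReal.tendsto_ofReal ((hn.add (hr.rpow_const (Or.inr hq.le))).const_mul M)

theorem tendsto_zero_of_le_rate (hp : p < 0) (hq : 0 < q) (hr₀ : 0 < r₀)
    (hmono : ∀ n, Monotone (R n))
    (hR : ∀ n, 1 ≤ n → ∀ r, 0 < r → r ≤ r₀ → R n r ≤ ENNReal.ofReal (M * ((n : ℝ) ^ p + r ^ q))) :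
    Tendsto (fun n => R n 0) atTop (𝓝 0) := by
  have hrate := tendsto_ofReal_mul_natCast_rpow_add_rpow hp hq M
    (tendsto_const_div_atTop_nhds_zero_nat r₀)
  rw [Real.zero_rpow hq.ne', mul_zero, ENNReal.ofReal_zero] at hrate
  refine tendsto_of_tendsto_of_tendsto_of_le_of_le' tendsto_const_nhds hrate
    (.of_forall fun _ => zero_le) ((eventually_ge_atTop 1).mono fun n hn => ?_)
  have hrn : 0 < r₀ / n := div_pos hr₀ (Nat.cast_pos.2 hn)
  exact (hmono n hrn.le).trans
    (hR n hn _ hrn (div_le_self hr₀.le (Nat.one_le_cast.2 hn)))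

theorem not_tendsto_top_of_le_rate (hp : p < 0) (hq : 0 < q) (hr₀ : 0 < r₀)
    (hR : ∀ n, 1 ≤ n → ∀ r, 0 < r → r ≤ r₀ → R n r ≤ ENNReal.ofReal (M * ((n : ℝ) ^ p + r ^ q))) :
    ¬ Tendsto (fun n => R n r₀) atTop (𝓝 ∞) := fun htop =>
  ENNReal.ofReal_ne_top <| top_le_iff.1 <| le_of_tendsto_of_tendsto htop
    (tendsto_ofReal_mul_natCast_rpow_add_rpow hp hq M tendsto_const_nhds)
    ((eventually_ge_atTop 1).mono fun n hn => hR n hn r₀ hr₀ le_rfl)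

end RateBounds

section AdversarialRisk

variable {d : ℕ} {μ : Measure (UnitCube d)} {ν : Measure ℝ}

theorem IsCovariateLaw.cubeVolume_absolutelyContinuous (hμ : IsCovariateLaw μ) :
    cubeVolume d ≪ μ := by
  obtain ⟨-, p, c, C, hp, hc, hcp, rfl⟩ := hμ
  exact withDensity_absolutelyContinuous' hp.ennreal_ofReal.aemeasurable
    (.of_forall fun x => (ENNReal.ofReal_pos.2 (hc.trans_le (hcp x).1)).ne')

theorem adversarialRisk_mono {n : ℕ} (μ : Measure (UnitCube d)) (ν : Measure ℝ)
    (F : (Fin n → UnitCube d × ℝ) → C(UnitCube d, ℝ)) (f : UnitCube d → ℝ) :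
    Monotone fun r => adversarialRisk μ ν r F f := fun _ _ h =>
  lintegral_mono fun _ => adversarialLoss_mono μ _ f h

theorem measurable_uncurry_of_isEstimator
    {F : (n : ℕ) → (Fin n → UnitCube d × ℝ) → C(UnitCube d, ℝ)} (hF : IsEstimator F)
    {f : UnitCube d → ℝ} (hf : Measurable f) (n : ℕ) :
    Measurable (Function.uncurry fun (z : Fin n → UnitCube d × ℝ) =>
      ⇑(F n fun i => ((z i).1, f (z i).1 + (z i).2))) :=
  (measurable_uncurry_of_continuous_of_measurable
    (u := fun x (z : Fin n → UnitCube d × ℝ) => F n (fun i => ((z i).1, f (z i).1 + (z i).2)) x)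
    (fun _ => map_continuous _) fun x => (hF n x).comp (by fun_prop)).comp measurable_swap

theorem tendsto_adversarialRisk_top [IsProbabilityMeasure μ] [IsProbabilityMeasure ν]
    {f : UnitCube d → ℝ} (hf : Measurable f) {x₀ : UnitCube d}
    (hunbdd : ∀ K : ℝ, ∃ᶠ x in 𝓝 x₀ ⊓ ae μ, K ≤ f x)
    {F : (n : ℕ) → (Fin n → UnitCube d × ℝ) → C(UnitCube d, ℝ)} (hF : IsEstimator F)
    (hconv : Tendsto (fun n => adversarialRisk μ ν 0 (F n) f) atTop (𝓝 0)) {r : ℝ} (hr : 0 < r) :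
    Tendsto (fun n => adversarialRisk μ ν r (F n) f) atTop (𝓝 ∞) :=
  tendsto_lintegral_adversarialLoss_top (measurable_uncurry_of_isEstimator hF hf) hf hunbdd hconv hr

theorem exists_mem_sobolevBall_tendsto_adversarialRisk_top (d : ℕ) [NeZero d] {L : ℝ}
    (hL : 0 < L) :
    ∃ f : UnitCube d → ℝ, Measurable f ∧ f ∈ sobolevBall d (d / 2) L ∧
      ∀ (μ : Measure (UnitCube d)) [IsProbabilityMeasure μ], cubeVolume d ≪ μ →
      ∀ (ν : Measure ℝ) [IsProbabilityMeasure ν]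
        (F : (n : ℕ) → (Fin n → UnitCube d × ℝ) → C(UnitCube d, ℝ)), IsEstimator F →
        Tendsto (fun n => adversarialRisk μ ν 0 (F n) f) atTop (𝓝 0) →
        ∀ r : ℝ, 0 < r → Tendsto (fun n => adversarialRisk μ ν r (F n) f) atTop (𝓝 ∞) := by
  obtain ⟨f, hf, hfL, htop⟩ := exists_mem_sobolevBall_tendsto_atTop d hL
  refine ⟨f, hf, hfL, fun μ _ hμ ν _ F hF hconv r hr => tendsto_adversarialRisk_top
    (x₀ := ⟨0, zero_mem_unitCube d⟩) hf (fun K => ?_) hF hconv hr⟩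
  have := nhds_inf_ae_neBot_of_mem_support (μ := cubeVolume d) (x := ⟨0, zero_mem_unitCube d⟩)
    (by rw [Measure.support_eq_univ]; exact Set.mem_univ _)
  exact (htop.eventually_ge_atTop K).frequently.filter_mono (inf_le_inf_left _ hμ.ae_le)

end AdversarialRisk

theorem theorem3p4_general (d : ℕ) (hd : 1 ≤ d) (L : ℝ) (hL : 0 < L) :
    ∃ f_ill : UnitCube d → ℝ, Measurable f_ill ∧ f_ill ∈ sobolevBall d ((d : ℝ) / 2) L ∧
      ∀ (p q : ℝ), p < 0 → 0 < q →
      ∀ (μ : Measure (UnitCube d)), IsProbabilityMeasure μ → cubeVolume d ≪ μ →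
      ∀ (ν : Measure ℝ), IsProbabilityMeasure ν →
      ∀ (r₀ : ℝ), 0 < r₀ →
        ¬ ∃ (F : (n : ℕ) → (Fin n → UnitCube d × ℝ) → C(UnitCube d, ℝ)) (M : ℝ),
          IsEstimator F ∧
          ∀ (n : ℕ), 1 ≤ n → ∀ (r : ℝ), 0 < r → r ≤ r₀ →
            adversarialRisk μ ν r (F n) f_ill ≤ ENNReal.ofReal (M * ((n : ℝ) ^ p + r ^ q)) := by
  have : NeZero d := ⟨Nat.one_le_iff_ne_zero.1 hd⟩
  obtain ⟨f, hf, hfL, hblowup⟩ := exists_mem_sobolevBall_tendsto_adversarialRisk_top d hL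
  refine ⟨f, hf, hfL, ?_⟩
  rintro p q hp hq μ _ hμ ν _ r₀ hr₀ ⟨F, M, hF, hrisk⟩
  have hconsistent : Tendsto (fun n => adversarialRisk μ ν 0 (F n) f) atTop (𝓝 0) :=
    tendsto_zero_of_le_rate hp hq hr₀ (fun n => adversarialRisk_mono μ ν (F n) f) hrisk
  exact not_tendsto_top_of_le_rate hp hq hr₀ hrisk (hblowup μ hμ ν F hF hconsistent r₀ hr₀)

theorem theorem3p4 (d : ℕ) (hd : 1 ≤ d) (L : ℝ) (hL : 0 < L) :
    ∃ f_ill : UnitCube d → ℝ, Measurable f_ill ∧ f_ill ∈ sobolevBall d ((d : ℝ) / 2) L ∧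
      ∀ (s : ℝ), 0 < s →
      ∀ (μ : Measure (UnitCube d)), IsCovariateLaw μ →
      ∀ (σ : ℝ≥0) (ν : Measure ℝ), IsNoiseLaw σ ν →
      ∀ (r₀ : ℝ), 0 < r₀ →
        ¬ ∃ (F : (n : ℕ) → (Fin n → UnitCube d × ℝ) → C(UnitCube d, ℝ)) (M : ℝ),
          IsEstimator F ∧
          ∀ (n : ℕ), 1 ≤ n → ∀ (r : ℝ), 0 < r → r ≤ r₀ →
            adversarialRisk μ ν r (F n) f_ill ≤
              ENNReal.ofReal
                (M * ((n : ℝ) ^ (-(2 * s) / (2 * s + d)) + r ^ (2 * min 1 s))) := by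
  obtain ⟨f, hf, hfL, hrate⟩ := theorem3p4_general d hd L hL
  exact ⟨f, hf, hfL, fun s hs μ hμ _ ν hν => hrate _ _
    (div_neg_of_neg_of_pos (by linarith) (by positivity)) (by positivity)
    μ hμ.1 hμ.cubeVolume_absolutelyContinuous ν hν.1⟩
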